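/- **Lipschitz continuity of quantum dynamical landscapes.** Let $\mathcal H$ be a finite-dimensional complex Hilbert space, $M\ge 1$ and $N\ge 0$ integers, $\delta t>0$, and let $H^{(0)}$ (drift), $H^{(1)},\dots,H^{(M)}$ (control Hamiltonians) and $O$ (observable) be self-adjoint operators on $\mathcal H$ and $\psi\in\mathcal H$ a unit vector. Assume that all control Hamiltonians have the same maximum transition frequency $$\omega_{\max}=\bigl|\lambda_{\max}(H^{(\mu)})-\lambda_{\min}(H^{(\mu)})\bigr|\qquad(\mu=1,\dots,M),$$ where $\lambda_{\max}$ and $\lambda_{\min}$ denote the largest and the smallest eigenvalue. For a matrix of controls $\boldsymbol U=(u_{\mu\nu})\in\mathbb R^{M\times N}$ put $$\hat U(\boldsymbol U)=e^{-i\,\delta t\,(H^{(0)}+\sum_{\mu}u_{\mu N}H^{(\mu)})}\cdots e^{-i\,\delta t\,(H^{(0)}+\sum_{\mu}u_{\mu 1}H^{(\mu)})},\qquad J(\boldsymbol U)=\langle\psi|\hat U(\boldsymbol U)^\dagger\,O\,\hat U(\boldsymbol U)|\psi\rangle,$$ $$\Delta O=\max_{\|\varphi\|=1}\langle\varphi|O|\varphi\rangle-\min_{\|\varphi\|=1}\langle\varphi|O|\varphi\rangle,\qquad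 \|\boldsymbol U\|_1=\sum_{\mu,\nu}|u_{\mu\nu}|.$$ 1. There is a constant $K$ with $0\le K\le \omega_{\max}\,\delta t\,\Delta O/2$ such that $|J(\boldsymbol U)-J(\boldsymbol U')|\le K\,\|\boldsymbol U-\boldsymbol U'\|_1$ for all $\boldsymbol U,\boldsymbol U'\in\mathbb R^{M\times N}$. 2. There is a constant $K_c$ with $0\le K_c\le(\omega_{\max}\,\delta t)^2\,\Delta O/2$ such that, for every critical point $\boldsymbol U$ of $J$ (that is, $\partial_{\mu\nu}J(\boldsymbol U)=0$ for all $\mu,\nu$) and every $\boldsymbol U'\in\mathbb R^{M\times N}$, $|J(\boldsymbol U)-J(\boldsymbol U')|\le K_c\,\|\boldsymbol U-\boldsymbol U'\|_1^2$. -/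

import Mathlib

namespace QuantumControl

noncomputable section

/-- The Hamiltonian `H⁰ + ∑ μ, u μ • H μ` with drift `H0`, control Hamiltonians `Hc` and
control amplitudes `u`. -/
def hamiltonian {ℋ : Type*} [NormedAddCommGroup ℋ] [InnerProductSpace ℂ ℋ] {M : ℕ}
    (H0 : ℋ →L[ℂ] ℋ) (Hc : Fin M → (ℋ →L[ℂ] ℋ)) (u : Fin M → ℝ) : ℋ →L[ℂ] ℋ :=
  H0 + ∑ μ, (u μ : ℂ) • Hc μ

/-- The time-step unitary `exp (-i δt H(u))`. -/
def stepUnitary {ℋ : Type*} [NormedAddCommGroup ℋ] [InnerProductSpace ℂ ℋ] {M : ℕ}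
    (H0 : ℋ →L[ℂ] ℋ) (Hc : Fin M → (ℋ →L[ℂ] ℋ)) (δt : ℝ) (u : Fin M → ℝ) : ℋ →L[ℂ] ℋ :=
  NormedSpace.exp ((-(Complex.I * (δt : ℂ))) • hamiltonian H0 Hc u)

/-- The time-ordered product `U(u_N) ⋯ U(u_1)` of the time-step unitaries; `U μ ν` is the value
of the `μ`-th control at the `ν`-th time step. Earlier steps stand further to the right. -/
def propagator {ℋ : Type*} [NormedAddCommGroup ℋ] [InnerProductSpace ℂ ℋ] {M N : ℕ}
    (H0 : ℋ →L[ℂ] ℋ) (Hc : Fin M → (ℋ →L[ℂ] ℋ)) (δt : ℝ) (U : Fin M → Fin N → ℝ) :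
    ℋ →L[ℂ] ℋ :=
  (List.ofFn fun ν => stepUnitary H0 Hc δt fun μ => U μ ν).reverse.prod

/-- The expectation value `⟨φ|O|φ⟩`, which is real for a self-adjoint operator `O`. -/
def expectation {ℋ : Type*} [NormedAddCommGroup ℋ] [InnerProductSpace ℂ ℋ]
    (O : ℋ →L[ℂ] ℋ) (φ : ℋ) : ℝ :=
  (inner ℂ φ (O φ)).re

/-- The quantum dynamical landscape: the expectation value of `O` in the final state
`U(u_N) ⋯ U(u_1) ψ`. -/
def landscape {ℋ : Type*} [NormedAddCommGroup ℋ] [InnerProductSpace ℂ ℋ] {M N : ℕ}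
    (H0 : ℋ →L[ℂ] ℋ) (Hc : Fin M → (ℋ →L[ℂ] ℋ)) (δt : ℝ) (O : ℋ →L[ℂ] ℋ) (ψ : ℋ)
    (U : Fin M → Fin N → ℝ) : ℝ :=
  expectation O (propagator H0 Hc δt U ψ)

/-- The set of real eigenvalues of an operator (all its eigenvalues, if it is self-adjoint). -/
def eigenvalueSet {ℋ : Type*} [NormedAddCommGroup ℋ] [InnerProductSpace ℂ ℋ]
    (A : ℋ →L[ℂ] ℋ) : Set ℝ :=
  {x : ℝ | Module.End.HasEigenvalue (A : ℋ →ₗ[ℂ] ℋ) (x : ℂ)}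

/-- The maximum transition frequency `|λ_max - λ_min|`: the distance between the largest and the
smallest eigenvalue of a self-adjoint operator on a nonzero finite-dimensional space. -/
def maxTransitionFrequency {ℋ : Type*} [NormedAddCommGroup ℋ] [InnerProductSpace ℂ ℋ]
    (A : ℋ →L[ℂ] ℋ) : ℝ :=
  |sSup (eigenvalueSet A) - sInf (eigenvalueSet A)|

/-- The set of expectation values of `O` over all (normalized) states. -/
def expectationRange {ℋ : Type*} [NormedAddCommGroup ℋ] [InnerProductSpace ℂ ℋ]
    (O : ℋ →L[ℂ] ℋ) : Set ℝ :=
  {x : ℝ | ∃ φ : ℋ, ‖φ‖ = 1 ∧ expectation O φ = x}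

/-- `ΔO`: the maximum minus the minimum of `⟨φ|O|φ⟩` over all (normalized) states `φ`. -/
def observableSpread {ℋ : Type*} [NormedAddCommGroup ℋ] [InnerProductSpace ℂ ℋ]
    (O : ℋ →L[ℂ] ℋ) : ℝ :=
  sSup (expectationRange O) - sInf (expectationRange O)

/-- The entrywise `ℓ¹` norm of a matrix of controls. -/
def l1Norm {M N : ℕ} (U : Fin M → Fin N → ℝ) : ℝ :=
  ∑ μ, ∑ ν, |U μ ν|

/-- All partial derivatives of `J` at `U` exist and vanish. -/
def IsCriticalPoint {M N : ℕ} (J : (Fin M → Fin N → ℝ) → ℝ) (U : Fin M → Fin N → ℝ) : Prop :=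
  ∀ μ ν, HasDerivAt (fun x : ℝ => J (Function.update U μ (Function.update (U μ) ν x))) 0 (U μ ν)

end

end QuantumControl

/-!
The landscape does not see the zero points of the energies: subtracting a real multiple of the
identity from a control Hamiltonian changes the propagator by a global phase, which cancels in the
expectation value, and subtracting one from the observable shifts the landscape by a constant.
Choosing the midpoints of the spectra, the control Hamiltonians may therefore be taken to have
operator norm at most `ωmax / 2` and the observable to have norm at most `ΔO / 2`
(`norm_sub_center_le`).

Along a line of controls `U + t • D` each time step is `exp (X + t • Y)` with `X`, `Y`
skew-adjoint. Duhamel's interpolation `r ↦ exp ((1 - r) X) exp (r Y)` and unitarity show that the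
first differences of this curve are bounded by `‖Y‖ |t - s|` and its mixed second differences by
`‖Y‖² |h| |t - s|` (`DiffBounds.exp_affine`). Such bounds multiply like exponentials, their rates
adding up (`DiffBounds.mul`), so `V† O V` for the propagator `V` satisfies them with constant `‖O‖`
and rate `2 a`, where `a = (ωmax / 2) δt ‖D‖₁` (`diffBounds_landscape`).

The first differences give the Lipschitz bound with `(ΔO / 2) (2 a) = ωmax δt ΔO ‖D‖₁ / 2`.
At a critical point all directional derivatives vanish, since the landscape is differentiable, and
the second differences bound the derivative along the line by `‖O‖ (2 a)² t`; the mean value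
inequality then gives the quadratic bound.
-/

namespace QuantumControl

/-! ### Finite-difference bounds -/

/-- The curve `f` has values of norm at most `C`, first differences of size `C a |t - s|`, and
mixed second differences of size `C a² |h| |t - s|`; these are the bounds that
`‖f‖ ≤ C`, `‖f'‖ ≤ C a` and `‖f''‖ ≤ C a²` would give. Stated without derivatives, they pass
to products by algebra alone (`DiffBounds.mul`). -/
structure DiffBounds {E : Type*} [SeminormedAddCommGroup E] (f : ℝ → E) (C a : ℝ) : Prop where
  norm_le : ∀ t, ‖f t‖ ≤ C
  sub_le : ∀ t s, ‖f t - f s‖ ≤ C * a * |t - s|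
  sub_sub_le : ∀ t s h, ‖(f (t + h) - f t) - (f (s + h) - f s)‖ ≤ C * a ^ 2 * |h| * |t - s|

theorem DiffBounds.const {E : Type*} [SeminormedAddCommGroup E] (x : E) :
    DiffBounds (fun _ => x) ‖x‖ 0 := by
  constructor <;> simp

theorem DiffBounds.star {E : Type*} [SeminormedAddCommGroup E] [StarAddMonoid E]
    [NormedStarGroup E] {f : ℝ → E} {C a : ℝ} (hf : DiffBounds f C a) :
    DiffBounds (fun t => star (f t)) C a := by
  constructor
  · simpa using hf.norm_le
  · intro t s
    simpa [← star_sub] using hf.sub_le t s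
  · intro t s h
    simpa [← star_sub] using hf.sub_sub_le t s h

theorem DiffBounds.mul {A : Type*} [SeminormedRing A] {f g : ℝ → A} {C D a b : ℝ}
    (hf : DiffBounds f C a) (hg : DiffBounds g D b) (ha : 0 ≤ a) :
    DiffBounds (fun t => f t * g t) (C * D) (a + b) := by
  have hC : 0 ≤ C := (norm_nonneg _).trans (hf.norm_le 0)
  have hmul : ∀ {x y : A} {p q : ℝ}, ‖x‖ ≤ p → ‖y‖ ≤ q → 0 ≤ p → ‖x * y‖ ≤ p * q :=
    fun hx hy hp => (norm_mul_le _ _).trans (mul_le_mul hx hy (norm_nonneg _) hp)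
  refine ⟨fun t => hmul (hf.norm_le t) (hg.norm_le t) hC, fun t s => ?_, fun t s h => ?_⟩
  · have h1 := hmul (hf.sub_le t s) (hg.norm_le t) (by positivity)
    have h2 := hmul (hf.norm_le s) (hg.sub_le t s) hC
    calc ‖f t * g t - f s * g s‖ = ‖(f t - f s) * g t + f s * (g t - g s)‖ := by
          congr 1; noncomm_ring
      _ ≤ C * a * |t - s| * D + C * (D * b * |t - s|) := norm_add_le_of_le h1 h2
      _ = C * D * (a + b) * |t - s| := by ring
  · have h1 := hmul (hf.sub_sub_le t s h) (hg.norm_le (t + h)) (by positivity)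
    have h2 := hmul (hf.sub_le (s + h) s) (hg.sub_le (t + h) (s + h)) (by positivity)
    have h3 := hmul (hf.sub_le t s) (hg.sub_le (t + h) t) (by positivity)
    have h4 := hmul (hf.norm_le s) (hg.sub_sub_le t s h) hC
    rw [add_sub_cancel_left] at h2 h3
    rw [add_sub_add_right_eq_sub] at h2
    calc ‖(f (t + h) * g (t + h) - f t * g t) - (f (s + h) * g (s + h) - f s * g s)‖
        = ‖((f (t + h) - f t) - (f (s + h) - f s)) * g (t + h)
            + (f (s + h) - f s) * (g (t + h) - g (s + h))
            + (f t - f s) * (g (t + h) - g t)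
            + f s * ((g (t + h) - g t) - (g (s + h) - g s))‖ := by
          congr 1; noncomm_ring
      _ ≤ C * a ^ 2 * |h| * |t - s| * D + C * a * |h| * (D * b * |t - s|)
            + C * a * |t - s| * (D * b * |h|) + C * (D * b ^ 2 * |h| * |t - s|) :=
          norm_add_le_of_le (norm_add_le_of_le (norm_add_le_of_le h1 h2) h3) h4
      _ = C * D * (a + b) ^ 2 * |h| * |t - s| := by ring

theorem DiffBounds.list_prod {A ι : Type*} [SeminormedRing A] [NormOneClass A] (l : List ι)
    {f : ι → ℝ → A} {a : ι → ℝ} (hf : ∀ i, DiffBounds (f i) 1 (a i)) (ha : ∀ i, 0 ≤ a i) :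
    DiffBounds (fun t => (l.map fun i => f i t).prod) 1 (l.map a).sum := by
  induction l with
  | nil => simpa using DiffBounds.const (1 : A)
  | cons i l ih => simpa using (hf i).mul ih (ha i)

/-- A differentiable real function with the difference bounds and a stationary point at `0`
departs quadratically from it: its derivative at `t` is bounded by `C a² |t|`. -/
theorem DiffBounds.abs_sub_le_of_deriv_eq_zero {g : ℝ → ℝ} {C a : ℝ} (hg : DiffBounds g C a)
    (hd : Differentiable ℝ g) (h0 : deriv g 0 = 0) : |g 1 - g 0| ≤ C * a ^ 2 := by
  have hC : 0 ≤ C := (norm_nonneg _).trans (hg.norm_le 0)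
  refine norm_image_sub_le_of_norm_deriv_le_segment_01' (f' := deriv g)
    (fun t _ => (hd t).hasDerivAt.hasDerivWithinAt) fun t ht => ?_
  -- `g' t - g' 0` is the derivative at `0` of the Lipschitz function `h ↦ g (t + h) - g h`.
  have hderiv : HasDerivAt (fun h => g (t + h) - g h) (deriv g t) 0 := by
    have h1 : HasDerivAt g (deriv g t) (t + 0) := by simpa using (hd t).hasDerivAt
    exact ((h1.comp_const_add t 0).sub (hd 0).hasDerivAt).congr_deriv (by rw [h0, sub_zero])
  have hlip : LipschitzWith (C * a ^ 2).toNNReal (fun h => g (t + h) - g h) := by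
    refine LipschitzWith.of_dist_le_mul fun x y => ?_
    have h1 := hg.sub_sub_le (t + y) y (x - y)
    rw [Real.coe_toNNReal _ (by positivity), dist_eq_norm, dist_eq_norm, Real.norm_eq_abs (x - y)]
    have h2 : |t + y - y| ≤ 1 := by
      rw [add_sub_cancel_right, abs_of_nonneg ht.1]; exact ht.2.le
    calc ‖(g (t + x) - g x) - (g (t + y) - g y)‖
        = ‖(g (t + y + (x - y)) - g (t + y)) - (g (y + (x - y)) - g y)‖ := by
          rw [add_assoc, add_sub_cancel]; congr 1; ring
      _ ≤ C * a ^ 2 * |x - y| * |t + y - y| := h1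
      _ ≤ C * a ^ 2 * |x - y| * 1 := by gcongr
      _ = C * a ^ 2 * |x - y| := mul_one _
  simpa [Real.coe_toNNReal _ (show 0 ≤ C * a ^ 2 by positivity)] using hderiv.le_of_lipschitz hlip

/-! ### Exponentials of skew-adjoint elements -/

section Exp

variable {A : Type*} [CStarAlgebra A]

theorem exp_mem_unitary {X : A} (hX : X ∈ skewAdjoint A) :
    NormedSpace.exp X ∈ unitary A :=
  letI := NormedAlgebra.restrictScalars ℚ ℂ A
  NormedSpace.exp_mem_unitary_of_mem_skewAdjoint hX

theorem norm_exp_le_one {X : A} (hX : X ∈ skewAdjoint A) : ‖NormedSpace.exp X‖ ≤ 1 := by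
  nontriviality A
  exact (CStarRing.norm_of_mem_unitary (exp_mem_unitary hX)).le

/-- The interpolation between `exp X` at `r = 0` and `exp Y` at `r = 1` whose derivative is the
integrand of Duhamel's formula. -/
theorem hasDerivAt_exp_mul_exp (X Y : A) (r : ℝ) :
    HasDerivAt (fun r : ℝ => NormedSpace.exp ((1 - r) • X) * NormedSpace.exp (r • Y))
      (NormedSpace.exp ((1 - r) • X) * (Y - X) * NormedSpace.exp (r • Y)) r := by
  have h1 := (hasDerivAt_exp_smul_const (𝕂 := ℝ) X (1 - r)).scomp r
    ((hasDerivAt_id r).const_sub 1)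
  have h2 := hasDerivAt_exp_smul_const' (𝕂 := ℝ) Y r
  refine (h1.mul h2).congr_deriv ?_
  simp only [Function.comp_apply, neg_smul, one_smul]
  noncomm_ring

theorem norm_exp_sub_exp_le {X Y : A} (hX : X ∈ skewAdjoint A) (hY : Y ∈ skewAdjoint A) :
    ‖NormedSpace.exp X - NormedSpace.exp Y‖ ≤ ‖X - Y‖ := by
  have key := norm_image_sub_le_of_norm_deriv_le_segment_01' (C := ‖X - Y‖)
    (fun r _ => (hasDerivAt_exp_mul_exp Y X r).hasDerivWithinAt) fun r _ => by
      have h1 := norm_exp_le_one (skewAdjoint.smul_mem (1 - r) hY)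
      have h2 := norm_exp_le_one (skewAdjoint.smul_mem r hX)
      calc _ ≤ 1 * ‖X - Y‖ * 1 := norm_mul_le_of_le (norm_mul_le_of_le h1 le_rfl) h2
        _ = ‖X - Y‖ := by ring
  simpa using key

/-- The second difference of the exponential over a parallelogram of skew-adjoint elements is
bounded by the product of the side lengths. -/
theorem norm_exp_second_difference_le {X₁ X₂ X₃ X₄ : A} (h₁ : X₁ ∈ skewAdjoint A)
    (h₂ : X₂ ∈ skewAdjoint A) (h₃ : X₃ ∈ skewAdjoint A) (h₄ : X₄ ∈ skewAdjoint A)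
    (h : X₁ - X₂ = X₃ - X₄) :
    ‖(NormedSpace.exp X₁ - NormedSpace.exp X₂) - (NormedSpace.exp X₃ - NormedSpace.exp X₄)‖
      ≤ ‖X₁ - X₂‖ * ‖X₁ - X₃‖ := by
  have h' : X₂ - X₄ = X₁ - X₃ := by
    rw [sub_eq_sub_iff_add_eq_add] at h ⊢; rw [h, add_comm]
  have key := norm_image_sub_le_of_norm_deriv_le_segment_01' (C := ‖X₁ - X₂‖ * ‖X₁ - X₃‖)
    (fun r _ => ((hasDerivAt_exp_mul_exp X₂ X₁ r).sub
      (hasDerivAt_exp_mul_exp X₄ X₃ r)).hasDerivWithinAt) fun r hr => by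
      have hr' : 0 ≤ 1 - r := by linarith [hr.2]
      have s₁ := skewAdjoint.smul_mem r h₁
      have s₂ := skewAdjoint.smul_mem (1 - r) h₂
      have s₃ := skewAdjoint.smul_mem r h₃
      have s₄ := skewAdjoint.smul_mem (1 - r) h₄
      have h24 := norm_exp_sub_exp_le s₂ s₄
      have h13 := norm_exp_sub_exp_le s₁ s₃
      rw [← smul_sub, norm_smul, Real.norm_of_nonneg hr', h'] at h24
      rw [← smul_sub, norm_smul, Real.norm_of_nonneg hr.1] at h13
      rw [← h]
      calc ‖NormedSpace.exp ((1 - r) • X₂) * (X₁ - X₂) * NormedSpace.exp (r • X₁)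
            - NormedSpace.exp ((1 - r) • X₄) * (X₁ - X₂) * NormedSpace.exp (r • X₃)‖
          = ‖(NormedSpace.exp ((1 - r) • X₂) - NormedSpace.exp ((1 - r) • X₄)) * (X₁ - X₂)
                * NormedSpace.exp (r • X₁)
              + NormedSpace.exp ((1 - r) • X₄) * (X₁ - X₂)
                * (NormedSpace.exp (r • X₁) - NormedSpace.exp (r • X₃))‖ := by
            congr 1; noncomm_ring
        _ ≤ (1 - r) * ‖X₁ - X₃‖ * ‖X₁ - X₂‖ * 1 + 1 * ‖X₁ - X₂‖ * (r * ‖X₁ - X₃‖) :=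
            norm_add_le_of_le
              (norm_mul_le_of_le (norm_mul_le_of_le h24 le_rfl) (norm_exp_le_one s₁))
              (norm_mul_le_of_le (norm_mul_le_of_le (norm_exp_le_one s₄) le_rfl) h13)
        _ = ‖X₁ - X₂‖ * ‖X₁ - X₃‖ := by ring
  refine le_of_eq_of_le ?_ key
  congr 1
  simp
  abel

/-- Along a line of skew-adjoint elements the exponential obeys the bounds that Duhamel's formula
gives for its first two derivatives. -/
theorem DiffBounds.exp_affine {X Y : A} {a : ℝ} (hX : X ∈ skewAdjoint A)
    (hY : Y ∈ skewAdjoint A) (hYa : ‖Y‖ ≤ a) :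
    DiffBounds (fun t : ℝ => NormedSpace.exp (X + t • Y)) 1 a := by
  have hXY : ∀ t : ℝ, X + t • Y ∈ skewAdjoint A := fun t =>
    add_mem hX (skewAdjoint.smul_mem t hY)
  have hsub : ∀ t s : ℝ, ‖(X + t • Y) - (X + s • Y)‖ ≤ a * |t - s| := fun t s => by
    rw [add_sub_add_left_eq_sub, ← sub_smul, norm_smul, Real.norm_eq_abs, mul_comm]
    gcongr
  refine ⟨fun t => norm_exp_le_one (hXY t), fun t s => ?_, fun t s h => ?_⟩
  · simpa using (norm_exp_sub_exp_le (hXY t) (hXY s)).trans (hsub t s)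
  · refine (norm_exp_second_difference_le (hXY _) (hXY _) (hXY _) (hXY _)
      (by simp only [add_smul]; abel)).trans ?_
    refine (mul_le_mul (hsub _ _) (hsub _ _) (norm_nonneg _)
      ((norm_nonneg _).trans (hsub _ _))).trans_eq ?_
    rw [add_sub_cancel_left, add_sub_add_right_eq_sub]
    ring

end Exp

variable {ℋ : Type*} [NormedAddCommGroup ℋ] [InnerProductSpace ℂ ℋ]

/-! ### Spectral centering -/

theorem isSelfAdjoint_ofReal_smul {A : Type*} [CStarAlgebra A] {a : A} (ha : IsSelfAdjoint a)
    (c : ℝ) : IsSelfAdjoint ((c : ℂ) • a) := by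
  rw [isSelfAdjoint_iff, star_smul, ha.star_eq, Complex.star_def, Complex.conj_ofReal]

/-- Subtracting the midpoint of the spectrum from a self-adjoint operator leaves an operator
whose norm is half the spectral width. -/
theorem norm_sub_center_le [CompleteSpace ℋ] [FiniteDimensional ℂ ℋ] [Nontrivial ℋ]
    {A : ℋ →L[ℂ] ℋ} (hA : IsSelfAdjoint A) {lo hi : ℝ}
    (h : ∀ x ∈ eigenvalueSet A, lo ≤ x ∧ x ≤ hi) :
    ‖A - (((lo + hi) / 2 : ℝ) : ℂ) • (1 : ℋ →L[ℂ] ℋ)‖ ≤ (hi - lo) / 2 := by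
  set c : ℝ := (lo + hi) / 2 with hc
  set B : ℋ →L[ℂ] ℋ := A - (c : ℂ) • (1 : ℋ →L[ℂ] ℋ) with hB
  have hBsa : IsSelfAdjoint B :=
    hA.sub (isSelfAdjoint_ofReal_smul (IsSelfAdjoint.one _) c)
  obtain ⟨z, hz, hnorm⟩ := spectrum.exists_nnnorm_eq_spectralRadius B
  rw [hBsa.spectralRadius_eq_nnnorm, ENNReal.coe_inj] at hnorm
  have hzre := hBsa.mem_spectrum_eq_re hz
  have hz' : Module.End.HasEigenvalue (B : ℋ →ₗ[ℂ] ℋ) z := by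
    rw [Module.End.hasEigenvalue_iff_mem_spectrum,
      ← AlgEquiv.spectrum_eq (Module.End.toContinuousLinearMap ℋ)]
    exact hz
  obtain ⟨v, hv⟩ := hz'.exists_hasEigenvector
  have hmem : z.re + c ∈ eigenvalueSet A := by
    refine Module.End.hasEigenvalue_of_hasEigenvector (x := v)
      (Module.End.hasEigenvector_iff.2 ⟨Module.End.mem_eigenspace_iff.2 ?_, hv.2⟩)
    have hBv : B v = z • v := hv.apply_eq_smul
    have hAv : A v = B v + (c : ℂ) • v := by simp [hB]
    rw [ContinuousLinearMap.coe_coe, hAv, hBv, Complex.ofReal_add, ← hzre, add_smul]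
  have hn : ‖B‖ = |z.re| := by
    rw [← coe_nnnorm, ← hnorm, coe_nnnorm, hzre, Complex.norm_real, Real.norm_eq_abs,
      Complex.ofReal_re]
  rw [hn, abs_le]
  obtain ⟨h1, h2⟩ := h _ hmem
  constructor <;> linarith

theorem abs_le_opNorm_of_mem_eigenvalueSet {A : ℋ →L[ℂ] ℋ} {x : ℝ}
    (hx : x ∈ eigenvalueSet A) : |x| ≤ ‖A‖ := by
  obtain ⟨v, hv⟩ := Module.End.HasEigenvalue.exists_hasEigenvector hx
  have h : A v = (x : ℂ) • v := hv.apply_eq_smul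
  have h1 := A.le_opNorm v
  rw [h, norm_smul, Complex.norm_real, Real.norm_eq_abs] at h1
  exact le_of_mul_le_mul_right h1 (norm_pos_iff.2 hv.2)

theorem exists_norm_sub_smul_le_maxTransitionFrequency [CompleteSpace ℋ]
    [FiniteDimensional ℂ ℋ] [Nontrivial ℋ] {A : ℋ →L[ℂ] ℋ} (hA : IsSelfAdjoint A) :
    ∃ c : ℝ, ‖A - (c : ℂ) • (1 : ℋ →L[ℂ] ℋ)‖ ≤ maxTransitionFrequency A / 2 := by
  have hbdd : ∀ x ∈ eigenvalueSet A, -‖A‖ ≤ x ∧ x ≤ ‖A‖ := fun x hx =>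
    abs_le.1 (abs_le_opNorm_of_mem_eigenvalueSet hx)
  refine ⟨_, (norm_sub_center_le hA fun x hx =>
    ⟨csInf_le ⟨_, fun y hy => (hbdd y hy).1⟩ hx, le_csSup ⟨_, fun y hy => (hbdd y hy).2⟩ hx⟩).trans
      ?_⟩
  have := le_abs_self (sSup (eigenvalueSet A) - sInf (eigenvalueSet A))
  unfold maxTransitionFrequency
  linarith

theorem abs_expectation_le (T : ℋ →L[ℂ] ℋ) {φ : ℋ} (hφ : ‖φ‖ = 1) :
    |expectation T φ| ≤ ‖T‖ := by
  calc |expectation T φ| ≤ ‖inner ℂ φ (T φ)‖ := Complex.abs_re_le_norm _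
    _ ≤ ‖φ‖ * ‖T φ‖ := norm_inner_le_norm _ _
    _ ≤ ‖φ‖ * (‖T‖ * ‖φ‖) := by gcongr; exact T.le_opNorm φ
    _ = ‖T‖ := by rw [hφ]; ring

theorem exists_norm_sub_smul_le_observableSpread [CompleteSpace ℋ]
    [FiniteDimensional ℂ ℋ] [Nontrivial ℋ] {O : ℋ →L[ℂ] ℋ} (hO : IsSelfAdjoint O) :
    ∃ c : ℝ, ‖O - (c : ℂ) • (1 : ℋ →L[ℂ] ℋ)‖ ≤ observableSpread O / 2 := by
  have hbdd : ∀ x ∈ expectationRange O, -‖O‖ ≤ x ∧ x ≤ ‖O‖ := by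
    rintro x ⟨φ, hφ, rfl⟩
    exact abs_le.1 (abs_expectation_le O hφ)
  have hsub : eigenvalueSet O ⊆ expectationRange O := by
    intro x hx
    obtain ⟨v, hv⟩ := Module.End.HasEigenvalue.exists_hasEigenvector hx
    have h : O v = (x : ℂ) • v := hv.apply_eq_smul
    have h1 : ‖((‖v‖⁻¹ : ℝ) : ℂ) • v‖ = 1 := by
      rw [norm_smul, Complex.norm_real, norm_inv, norm_norm,
        inv_mul_cancel₀ (norm_ne_zero_iff.2 hv.2)]
    refine ⟨((‖v‖⁻¹ : ℝ) : ℂ) • v, h1, ?_⟩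
    rw [expectation, map_smul, h, smul_comm, inner_smul_right, inner_self_eq_norm_sq_to_K, h1]
    simp
  exact ⟨_, norm_sub_center_le hO fun x hx =>
    ⟨csInf_le ⟨_, fun y hy => (hbdd y hy).1⟩ (hsub hx),
      le_csSup ⟨_, fun y hy => (hbdd y hy).2⟩ (hsub hx)⟩⟩

theorem expectation_sub (S T : ℋ →L[ℂ] ℋ) (φ : ℋ) :
    expectation (S - T) φ = expectation S φ - expectation T φ := by
  simp [expectation]

theorem DiffBounds.expectation {f : ℝ → (ℋ →L[ℂ] ℋ)} {C a : ℝ} (hf : DiffBounds f C a) {ψ : ℋ}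
    (hψ : ‖ψ‖ = 1) : DiffBounds (fun t => expectation (f t) ψ) C a := by
  refine ⟨fun t => (abs_expectation_le _ hψ).trans (hf.norm_le t), fun t s => ?_,
    fun t s h => ?_⟩
  · rw [← expectation_sub]
    exact (abs_expectation_le _ hψ).trans (hf.sub_le t s)
  · simp only [← expectation_sub]
    exact (abs_expectation_le _ hψ).trans (hf.sub_sub_le t s h)

/-! ### Unitarity and invariance of the landscape -/

theorem propagator_eq_prod_map {M N : ℕ} (H0 : ℋ →L[ℂ] ℋ) (Hc : Fin M → (ℋ →L[ℂ] ℋ)) (δt : ℝ)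
    (U : Fin M → Fin N → ℝ) :
    propagator H0 Hc δt U =
      ((List.finRange N).reverse.map fun ν => stepUnitary H0 Hc δt fun μ => U μ ν).prod := by
  rw [propagator, List.ofFn_eq_map, List.map_reverse]

section

variable [CompleteSpace ℋ] {M N : ℕ} {H0 : ℋ →L[ℂ] ℋ} {Hc : Fin M → (ℋ →L[ℂ] ℋ)}

theorem neg_I_smul_mem_skewAdjoint {A : ℋ →L[ℂ] ℋ} (hA : IsSelfAdjoint A) (δt : ℝ) :
    (-(Complex.I * (δt : ℂ))) • A ∈ skewAdjoint (ℋ →L[ℂ] ℋ) := by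
  rw [skewAdjoint.mem_iff, star_smul, hA.star_eq]
  simp

theorem isSelfAdjoint_sum_smul (hHc : ∀ μ, IsSelfAdjoint (Hc μ)) (u : Fin M → ℝ) :
    IsSelfAdjoint (∑ μ, (u μ : ℂ) • Hc μ) :=
  isSelfAdjoint_sum _ fun μ _ => isSelfAdjoint_ofReal_smul (hHc μ) (u μ)

theorem isSelfAdjoint_hamiltonian (hH0 : IsSelfAdjoint H0) (hHc : ∀ μ, IsSelfAdjoint (Hc μ))
    (u : Fin M → ℝ) : IsSelfAdjoint (hamiltonian H0 Hc u) :=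
  hH0.add (isSelfAdjoint_sum_smul hHc u)

theorem propagator_mem_unitary (hH0 : IsSelfAdjoint H0) (hHc : ∀ μ, IsSelfAdjoint (Hc μ)) (δt : ℝ)
    (U : Fin M → Fin N → ℝ) : propagator H0 Hc δt U ∈ unitary (ℋ →L[ℂ] ℋ) := by
  refine Submonoid.list_prod_mem _ fun x hx => ?_
  rw [List.mem_reverse, List.mem_ofFn] at hx
  obtain ⟨ν, rfl⟩ := hx
  exact exp_mem_unitary (neg_I_smul_mem_skewAdjoint (isSelfAdjoint_hamiltonian hH0 hHc _) δt)

theorem expectation_apply (O V : ℋ →L[ℂ] ℋ) (ψ : ℋ) :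
    expectation O (V ψ) = expectation (star V * O * V) ψ := by
  simp only [expectation, ContinuousLinearMap.star_eq_adjoint, mul_apply_eq_comp,
    ContinuousLinearMap.adjoint_inner_right]

theorem landscape_eq_expectation (H0 : ℋ →L[ℂ] ℋ) (Hc : Fin M → (ℋ →L[ℂ] ℋ)) (δt : ℝ)
    (O : ℋ →L[ℂ] ℋ) (ψ : ℋ) (U : Fin M → Fin N → ℝ) :
    landscape H0 Hc δt O ψ U =
      expectation (star (propagator H0 Hc δt U) * O * propagator H0 Hc δt U) ψ :=
  expectation_apply _ _ _

theorem landscape_sub_smul_one (hH0 : IsSelfAdjoint H0) (hHc : ∀ μ, IsSelfAdjoint (Hc μ)) (δt : ℝ)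
    (O : ℋ →L[ℂ] ℋ) {ψ : ℋ} (hψ : ‖ψ‖ = 1) (c : ℝ) (U : Fin M → Fin N → ℝ) :
    landscape H0 Hc δt (O - (c : ℂ) • (1 : ℋ →L[ℂ] ℋ)) ψ U = landscape H0 Hc δt O ψ U - c := by
  have hV := (Unitary.mem_iff.1 (propagator_mem_unitary hH0 hHc δt U)).1
  rw [landscape_eq_expectation, landscape_eq_expectation, mul_sub, sub_mul, expectation_sub,
    mul_smul_comm, mul_one, smul_mul_assoc, hV]
  simp [expectation, inner_self_eq_norm_sq_to_K, hψ]

theorem exp_add_smul_one {A : Type*} [CStarAlgebra A] (X : A) (z : ℂ) :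
    NormedSpace.exp (X + z • (1 : A)) = Complex.exp z • NormedSpace.exp X := by
  let := NormedAlgebra.restrictScalars ℚ ℂ A
  rw [NormedSpace.exp_add_of_commute ((Commute.one_right X).smul_right z),
    ← Algebra.algebraMap_eq_smul_one, ← NormedSpace.algebraMap_exp_comm,
    ← Complex.exp_eq_exp_ℂ, Algebra.algebraMap_eq_smul_one, mul_smul_comm, mul_one]

/-- Shifting the control Hamiltonians by real multiples of the identity multiplies each time-step
unitary by a phase. -/
theorem exists_stepUnitary_eq_smul (H0 : ℋ →L[ℂ] ℋ) (Hc : Fin M → (ℋ →L[ℂ] ℋ)) (δt : ℝ)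
    (c u : Fin M → ℝ) :
    ∃ z : ℂ, ‖z‖ = 1 ∧
      stepUnitary H0 (fun μ => Hc μ - (c μ : ℂ) • (1 : ℋ →L[ℂ] ℋ)) δt u =
        z • stepUnitary H0 Hc δt u := by
  refine ⟨Complex.exp ((δt * ∑ μ, u μ * c μ : ℝ) * Complex.I), Complex.norm_exp_ofReal_mul_I _, ?_⟩
  rw [stepUnitary, stepUnitary, ← exp_add_smul_one]
  congr 1
  simp only [hamiltonian, smul_sub, Finset.sum_sub_distrib, smul_smul, ← Finset.sum_smul]
  rw [← add_sub_assoc, smul_sub, smul_smul, sub_eq_add_neg, ← neg_smul]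
  congr 2
  push_cast
  ring

theorem exists_list_prod_map_eq_smul {ι A : Type*} [Ring A] [Algebra ℂ A] (l : List ι)
    {S T : ι → A} (h : ∀ i, ∃ z : ℂ, ‖z‖ = 1 ∧ S i = z • T i) :
    ∃ z : ℂ, ‖z‖ = 1 ∧ (l.map S).prod = z • (l.map T).prod := by
  induction l with
  | nil => exact ⟨1, by simp⟩
  | cons i l ih =>
    obtain ⟨z, hz, hST⟩ := ih
    obtain ⟨w, hw, hi⟩ := h i
    refine ⟨w * z, by simp [hz, hw], ?_⟩
    simp only [List.map_cons, List.prod_cons, hST, hi, smul_mul_smul_comm]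

/-- The phases caused by shifting the control Hamiltonians cancel in the expectation value. -/
theorem landscape_control_sub_smul_one (H0 : ℋ →L[ℂ] ℋ) (Hc : Fin M → (ℋ →L[ℂ] ℋ)) (δt : ℝ)
    (O : ℋ →L[ℂ] ℋ) (ψ : ℋ) (c : Fin M → ℝ) (U : Fin M → Fin N → ℝ) :
    landscape H0 (fun μ => Hc μ - (c μ : ℂ) • (1 : ℋ →L[ℂ] ℋ)) δt O ψ U =
      landscape H0 Hc δt O ψ U := by
  obtain ⟨z, hz, h⟩ := exists_list_prod_map_eq_smul (List.finRange N).reverse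
    fun ν => exists_stepUnitary_eq_smul H0 Hc δt c fun μ => U μ ν
  have hzz : star z * z = 1 := by
    rw [Complex.star_def, mul_comm, Complex.mul_conj, Complex.normSq_eq_norm_sq, hz]; simp
  rw [← propagator_eq_prod_map, ← propagator_eq_prod_map] at h
  rw [landscape_eq_expectation, landscape_eq_expectation, h, star_smul, smul_mul_assoc,
    smul_mul_smul_comm, hzz, one_smul]

/-! ### The landscape along a line of controls -/

theorem stepUnitary_line (H0 : ℋ →L[ℂ] ℋ) (Hc : Fin M → (ℋ →L[ℂ] ℋ)) (δt : ℝ) (u d : Fin M → ℝ)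
    (t : ℝ) :
    stepUnitary H0 Hc δt (u + t • d) =
      NormedSpace.exp ((-(Complex.I * (δt : ℂ))) • hamiltonian H0 Hc u +
        t • ((-(Complex.I * (δt : ℂ))) • ∑ μ, (d μ : ℂ) • Hc μ)) := by
  have h : hamiltonian H0 Hc (u + t • d) =
      hamiltonian H0 Hc u + (t : ℂ) • ∑ μ, (d μ : ℂ) • Hc μ := by
    simp [hamiltonian, add_smul, Finset.sum_add_distrib, Finset.smul_sum, mul_smul, add_assoc]
  rw [stepUnitary, h, smul_add, smul_comm _ (t : ℂ), Complex.coe_smul]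

theorem diffBounds_landscape [Nontrivial ℋ] (hH0 : IsSelfAdjoint H0)
    (hHc : ∀ μ, IsSelfAdjoint (Hc μ)) {w : ℝ} (hw : ∀ μ, ‖Hc μ‖ ≤ w) {δt : ℝ} (hδt : 0 ≤ δt)
    (O : ℋ →L[ℂ] ℋ) {ψ : ℋ} (hψ : ‖ψ‖ = 1) (U D : Fin M → Fin N → ℝ) :
    DiffBounds (fun t : ℝ => landscape H0 Hc δt O ψ (U + t • D)) ‖O‖
      (2 * (w * δt * l1Norm D)) := by
  have hb : ∀ ν, ‖(-(Complex.I * (δt : ℂ))) • ∑ μ, (D μ ν : ℂ) • Hc μ‖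
      ≤ δt * ∑ μ, |D μ ν| * w := fun ν => by
    rw [norm_smul, norm_neg, norm_mul, Complex.norm_I, one_mul, Complex.norm_real,
      Real.norm_of_nonneg hδt]
    gcongr
    refine norm_sum_le_of_le _ fun μ _ => ?_
    rw [norm_smul, Complex.norm_real, Real.norm_eq_abs]
    gcongr
    exact hw μ
  have hV := DiffBounds.list_prod (List.finRange N).reverse
    (fun ν => DiffBounds.exp_affine
      (neg_I_smul_mem_skewAdjoint (isSelfAdjoint_hamiltonian hH0 hHc fun μ => U μ ν) δt)
      (neg_I_smul_mem_skewAdjoint (isSelfAdjoint_sum_smul hHc fun μ => D μ ν) δt) (hb ν))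
    fun ν => (norm_nonneg _).trans (hb ν)
  have hsum : ((List.finRange N).reverse.map fun ν => δt * ∑ μ, |D μ ν| * w).sum
      = w * δt * l1Norm D := by
    rw [List.map_reverse, List.sum_reverse, ← List.ofFn_eq_map, List.sum_ofFn, l1Norm,
      Finset.sum_comm, ← Finset.mul_sum, Finset.mul_sum, Finset.mul_sum]
    refine Finset.sum_congr rfl fun ν _ => ?_
    rw [Finset.mul_sum, Finset.mul_sum]
    exact Finset.sum_congr rfl fun μ _ => by ring
  have hnonneg : 0 ≤ w * δt * l1Norm D := by
    rw [← hsum]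
    refine List.sum_nonneg fun x hx => ?_
    obtain ⟨ν, -, rfl⟩ := List.mem_map.1 hx
    exact (norm_nonneg _).trans (hb ν)
  rw [hsum] at hV
  -- The landscape is the expectation value of `V† O V`, a product of curves with rates `a, 0, a`.
  have h := ((hV.star.mul (DiffBounds.const O) hnonneg).mul hV (by simpa using hnonneg)).expectation
    hψ
  rw [one_mul, mul_one, add_zero, ← two_mul] at h
  convert h using 2 with t
  rw [landscape_eq_expectation, propagator_eq_prod_map]
  have hs : (fun ν => stepUnitary H0 Hc δt fun μ => (U + t • D) μ ν) = _ :=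
    funext fun ν => stepUnitary_line H0 Hc δt (fun μ => U μ ν) (fun μ => D μ ν) t
  rw [hs]

/-! ### Differentiability and critical points -/

theorem differentiable_list_prod_map {E A ι : Type*} [NormedAddCommGroup E] [NormedSpace ℝ E]
    [NormedRing A] [NormedAlgebra ℝ A] (l : List ι) {f : ι → E → A}
    (hf : ∀ i, Differentiable ℝ (f i)) : Differentiable ℝ fun x => (l.map fun i => f i x).prod := by
  induction l with
  | nil => simp
  | cons i l ih =>
    simp only [List.map_cons, List.prod_cons]
    exact (hf i).mul ih

theorem differentiable_landscape (H0 : ℋ →L[ℂ] ℋ) (Hc : Fin M → (ℋ →L[ℂ] ℋ)) (δt : ℝ)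
    (O : ℋ →L[ℂ] ℋ) (ψ : ℋ) :
    Differentiable ℝ fun U : Fin M → Fin N → ℝ => landscape H0 Hc δt O ψ U := by
  have hexp : Differentiable ℝ (NormedSpace.exp : (ℋ →L[ℂ] ℋ) → (ℋ →L[ℂ] ℋ)) := fun X =>
    (NormedSpace.exp_analytic (𝕂 := ℝ) X).differentiableAt
  have hV : Differentiable ℝ fun U : Fin M → Fin N → ℝ => propagator H0 Hc δt U := by
    simp only [propagator_eq_prod_map]
    refine differentiable_list_prod_map _ fun ν => hexp.comp ?_
    simp only [hamiltonian, Complex.coe_smul]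
    fun_prop
  let L : (ℋ →L[ℂ] ℋ) →L[ℝ] ℝ := Complex.reCLM.comp
    (((innerSL ℂ ψ).comp (ContinuousLinearMap.apply ℂ ℋ ψ)).restrictScalars ℝ)
  simp only [landscape_eq_expectation]
  exact L.differentiable.comp ((hV.star.mul (differentiable_const O)).mul hV)

/-- At a critical point of a differentiable function all directional derivatives vanish. -/
theorem IsCriticalPoint.fderiv_eq_zero {J : (Fin M → Fin N → ℝ) → ℝ} {U : Fin M → Fin N → ℝ}
    (hU : IsCriticalPoint J U) (hJ : DifferentiableAt ℝ J U) : fderiv ℝ J U = 0 := by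
  have hbasis : ∀ μ ν, fderiv ℝ J U (Pi.single μ (Pi.single ν 1)) = 0 := fun μ ν => by
    have h1 : HasDerivAt (fun x : ℝ => Function.update U μ (Function.update (U μ) ν x))
        (Pi.single μ (Pi.single ν 1)) (U μ ν) :=
      (hasFDerivAt_update U (U μ)).comp_hasDerivAt_of_eq (U μ ν)
        (hasDerivAt_update (U μ) ν (U μ ν)) (by simp) |>.congr_deriv (by
          ext i; by_cases h : i = μ <;> simp [Pi.single_apply, h])
    exact ((hJ.hasFDerivAt.comp_hasDerivAt_of_eq _ h1 (by simp)).unique (hU μ ν))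
  ext D
  have hD : D = ∑ μ, ∑ ν, D μ ν • Pi.single μ (Pi.single ν (1 : ℝ)) := by
    ext i j
    simp [Finset.sum_apply, Pi.single_apply, ite_apply]
  rw [hD]
  simp [hbasis]

end

/-! ### Lipschitz and quadratic bounds for bounded controls -/

theorem abs_landscape_sub_le [CompleteSpace ℋ] [Nontrivial ℋ] {M N : ℕ} {H0 : ℋ →L[ℂ] ℋ}
    {Hc : Fin M → (ℋ →L[ℂ] ℋ)} (hH0 : IsSelfAdjoint H0) (hHc : ∀ μ, IsSelfAdjoint (Hc μ)) {w : ℝ}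
    (hw : ∀ μ, ‖Hc μ‖ ≤ w) {δt : ℝ} (hδt : 0 ≤ δt) (O : ℋ →L[ℂ] ℋ) {ψ : ℋ} (hψ : ‖ψ‖ = 1)
    (U U' : Fin M → Fin N → ℝ) :
    |landscape H0 Hc δt O ψ U - landscape H0 Hc δt O ψ U'|
      ≤ ‖O‖ * (2 * (w * δt * l1Norm (U - U'))) := by
  simpa using (diffBounds_landscape hH0 hHc hw hδt O hψ U' (U - U')).sub_le 1 0

theorem abs_landscape_sub_le_of_isCriticalPoint [CompleteSpace ℋ] [Nontrivial ℋ] {M N : ℕ}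
    {H0 : ℋ →L[ℂ] ℋ} {Hc : Fin M → (ℋ →L[ℂ] ℋ)} (hH0 : IsSelfAdjoint H0)
    (hHc : ∀ μ, IsSelfAdjoint (Hc μ)) {w : ℝ} (hw : ∀ μ, ‖Hc μ‖ ≤ w) {δt : ℝ} (hδt : 0 ≤ δt)
    (O : ℋ →L[ℂ] ℋ) {ψ : ℋ} (hψ : ‖ψ‖ = 1) {U : Fin M → Fin N → ℝ}
    (hU : IsCriticalPoint (landscape H0 Hc δt O ψ) U) (U' : Fin M → Fin N → ℝ) :
    |landscape H0 Hc δt O ψ U - landscape H0 Hc δt O ψ U'|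
      ≤ ‖O‖ * (2 * (w * δt * l1Norm (U - U'))) ^ 2 := by
  have hJ := differentiable_landscape (N := N) H0 Hc δt O ψ
  have hline : ∀ t : ℝ, HasDerivAt (fun t : ℝ => U + t • (U' - U)) (U' - U) t := fun t => by
    simpa using ((hasDerivAt_id t).smul_const (U' - U)).const_add U
  have hg : ∀ t : ℝ, HasDerivAt (fun t : ℝ => landscape H0 Hc δt O ψ (U + t • (U' - U)))
      (fderiv ℝ (landscape H0 Hc δt O ψ) (U + t • (U' - U)) (U' - U)) t := fun t =>
    (hJ _).hasFDerivAt.comp_hasDerivAt t (hline t)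
  have hl1 : l1Norm (U' - U) = l1Norm (U - U') := by
    simp only [l1Norm, Pi.sub_apply, abs_sub_comm]
  have h := (diffBounds_landscape hH0 hHc hw hδt O hψ U (U' - U)).abs_sub_le_of_deriv_eq_zero
    (fun t => (hg t).differentiableAt)
    (by rw [(hg 0).deriv, zero_smul, add_zero, hU.fderiv_eq_zero (hJ U)]; rfl)
  rw [hl1] at h
  simpa [abs_sub_comm] using h

end QuantumControl

/-! ### The bounds in terms of spectral widths -/

theorem lemma5 {ℋ : Type*} [NormedAddCommGroup ℋ] [InnerProductSpace ℂ ℋ] [CompleteSpace ℋ]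
    [FiniteDimensional ℂ ℋ] {M N : ℕ} (hM : 0 < M)
    (H0 : ℋ →L[ℂ] ℋ) (hH0 : IsSelfAdjoint H0)
    (Hc : Fin M → (ℋ →L[ℂ] ℋ)) (hHc : ∀ μ, IsSelfAdjoint (Hc μ))
    (ωmax : ℝ) (hω : ∀ μ, QuantumControl.maxTransitionFrequency (Hc μ) = ωmax)
    (δt : ℝ) (hδt : 0 < δt)
    (O : ℋ →L[ℂ] ℋ) (hO : IsSelfAdjoint O) (ψ : ℋ) (hψ : ‖ψ‖ = 1) :
    (∃ K : ℝ, 0 ≤ K ∧ K ≤ ωmax * δt * QuantumControl.observableSpread O / 2 ∧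
      ∀ U U' : Fin M → Fin N → ℝ,
        |QuantumControl.landscape H0 Hc δt O ψ U - QuantumControl.landscape H0 Hc δt O ψ U'|
          ≤ K * QuantumControl.l1Norm (U - U')) ∧
    (∃ Kc : ℝ, 0 ≤ Kc ∧ Kc ≤ (ωmax * δt) ^ 2 * QuantumControl.observableSpread O / 2 ∧
      ∀ U : Fin M → Fin N → ℝ,
        QuantumControl.IsCriticalPoint (QuantumControl.landscape H0 Hc δt O ψ) U →
        ∀ U' : Fin M → Fin N → ℝ,
          |QuantumControl.landscape H0 Hc δt O ψ U - QuantumControl.landscape H0 Hc δt O ψ U'|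
            ≤ Kc * QuantumControl.l1Norm (U - U') ^ 2) := by
  have : Nontrivial ℋ := ⟨ψ, 0, fun h => by simp [h] at hψ⟩
  have hω0 : 0 ≤ ωmax := by rw [← hω ⟨0, hM⟩]; exact abs_nonneg _
  choose c hc using fun μ =>
    QuantumControl.exists_norm_sub_smul_le_maxTransitionFrequency (hHc μ)
  obtain ⟨o, ho⟩ := QuantumControl.exists_norm_sub_smul_le_observableSpread hO
  set Hs : Fin M → (ℋ →L[ℂ] ℋ) := fun μ => Hc μ - (c μ : ℂ) • (1 : ℋ →L[ℂ] ℋ) with hHs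
  set Os : ℋ →L[ℂ] ℋ := O - (o : ℂ) • (1 : ℋ →L[ℂ] ℋ) with hOs
  have hHs_sa : ∀ μ, IsSelfAdjoint (Hs μ) := fun μ =>
    (hHc μ).sub (QuantumControl.isSelfAdjoint_ofReal_smul (IsSelfAdjoint.one _) _)
  have hw : ∀ μ, ‖Hs μ‖ ≤ ωmax / 2 := fun μ => (hc μ).trans_eq (by rw [hω μ])
  -- The centered landscape differs from the original one by the constant `o`.
  have hJ : QuantumControl.landscape (N := N) H0 Hs δt Os ψ =
      fun U => QuantumControl.landscape H0 Hc δt O ψ U - o := funext fun U => by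
    rw [QuantumControl.landscape_sub_smul_one hH0 hHs_sa δt O hψ,
      QuantumControl.landscape_control_sub_smul_one]
  have hspread : 0 ≤ QuantumControl.observableSpread O := by
    linarith [norm_nonneg Os]
  have hl1 : ∀ V : Fin M → Fin N → ℝ, 0 ≤ QuantumControl.l1Norm V := fun V =>
    Finset.sum_nonneg fun _ _ => Finset.sum_nonneg fun _ _ => abs_nonneg _
  refine ⟨⟨ωmax * δt * QuantumControl.observableSpread O / 2, by positivity, le_rfl,
    fun U U' => ?_⟩, ⟨(ωmax * δt) ^ 2 * QuantumControl.observableSpread O / 2, by positivity,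
    le_rfl, fun U hU U' => ?_⟩⟩
  · have h := QuantumControl.abs_landscape_sub_le hH0 hHs_sa hw hδt.le Os hψ U U'
    simp only [hJ, sub_sub_sub_cancel_right] at h
    have h0 := hl1 (U - U')
    refine h.trans ((mul_le_mul_of_nonneg_right ho (by positivity)).trans_eq ?_)
    ring
  · have hU' : QuantumControl.IsCriticalPoint (QuantumControl.landscape H0 Hs δt Os ψ) U := by
      rw [hJ]
      exact fun μ ν => (hU μ ν).sub_const o
    have h := QuantumControl.abs_landscape_sub_le_of_isCriticalPoint hH0 hHs_sa hw hδt.le Os hψ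
      hU' U'
    simp only [hJ, sub_sub_sub_cancel_right] at h
    refine h.trans ((mul_le_mul_of_nonneg_right ho (by positivity)).trans_eq ?_)
    ring
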